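/- Let $G$ be a finite undirected graph. In the guessing game $(G,s)$ every vertex $v$ receives a value $a_v\in\{0,\dots,s-1\}$, uniformly and independently, sees exactly the values of its neighbours, and guesses its own value; a strategy $\mathcal F$ assigns to every vertex a function from the values of its neighbours to a guess, and $\mathrm{Win}(G,s,\mathcal F)$ is the event that all guesses are correct. Put $$\mathrm{gn}(G,s)=|V(G)|+\log_s\Bigl(\max_{\mathcal F}\mathbf P[\mathrm{Win}(G,s,\mathcal F)]\Bigr),\qquad \mathrm{gn}(G)=\lim_{s\to\infty}\mathrm{gn}(G,s).$$ A fractional clique cover of $G$ is a weighting $w$ of the cliques of $G$ by numbers in $[0,1]$ such that, for every vertex $v$, the weights of the cliques containing $v$ add up to at least $1$; $\kappa_f(G)$ is the minimum total weight of such a cover, and $|V(G)|-\kappa_f(G)$ is the fractional clique cover bound of $G$. The Shannon bound $\mathrm{Sh}(G)$ is the maximum of $h(V(G))$ over all functions $h$ from the subsets of $V(G)$ to $\mathbb R$ such that, for all $X,Y,Z,A,B\subseteq V(G)$: $h(X)\ge 0$; $h(X)\le|X|$; $h(X\cup Z)+h(Y\cup Z)-h(X\cup Y\cup Z)-h(Z)\ge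 0$; and $h(A\cup B)=h(B)$ whenever $B$ contains all neighbours of every vertex of $A$. The blowup $G(t)$ has vertex set $V(G)\times\{1,\dots,t\}$, with $(u,i)$ and $(v,j)$ adjacent if and only if $uv$ is an edge of $G$. Let $R$ be the undirected graph with vertices $1,\dots,10$ and the following $27$ edges: $1$ is joined to each of $2,\dots,7$; the vertices $2,3,4,5,6,7$ form a $6$-cycle in this order; $8$ is joined to $3,4,6,7$; $9$ is joined to $2,3,5,6$; $10$ is joined to $2,4,5,7$; and $8,9,10$ are pairwise adjacent. Let $R_c$ be the $13$-vertex graph obtained from $R$ by adding clones $8',9',10'$ of $8,9,10$ (two vertices of $R_c$ are adjacent if and only if the vertices of $R$ that they are copies of are adjacent). The $R_c$ strategy over the alphabet $\mathbb Z/3$ is based on the four conditions $$\begin{aligned} (1)\quad& a_1+a_2+2a_3+a_4+2a_5+a_6+2a_7=0, & (2)\quad& a_2+a_5+a_8+a_{8'}+a_9+a_{10'}=0,\\ (3)\quad& a_3+a_6+a_8+a_{9'}+a_{10}+a_{10'}=0, & (4)\quad& a_4+a_7+a_{8'}+a_9+a_{9'}+a_{10}=0. \end{aligned}$$ Each player guesses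 the value that makes a certain linear combination of them true, namely, writing the coefficients of $(1),(2),(3),(4)$ as a vector: player $1$ uses $(1,0,0,0)$; $2$ uses $(2,2,1,1)$; $3$ uses $(1,1,2,1)$; $4$ uses $(2,1,1,2)$; $5$ uses $(1,2,1,1)$; $6$ uses $(2,1,2,1)$; $7$ uses $(1,1,1,2)$; $8$ and $9'$ use $(0,0,1,0)$; $9$ and $10'$ use $(0,1,0,0)$; $10$ and $8'$ use $(0,0,0,1)$. **Theorem.** 1. $\mathrm{gn}(R)=27/4$ (in particular the limit exists). 2. The minimum defining $\kappa_f(R)$ is attained and the fractional clique cover bound of $R$ is $20/3$; in particular it differs from $\mathrm{gn}(R)=27/4$. 3. $\mathrm{Sh}(R)=27/4$. 4. The $40$ vertices of $R(4)$ can be partitioned into nine triangles $T_1,\dots,T_9$ and a set of $13$ vertices that induces a copy of $R_c$, such that there is a strategy $\mathcal F$ for the guessing game $(R(4),3)$ in which every vertex $v$ of every $T_i$ guesses $-\sum_{u\in T_i\setminus\{v\}}a_u \bmod 3$, the remaining $13$ vertices play the $R_c$ strategy on the copy of $R_c$, and $\mathbf P[\mathrm{Win}(R(4),3,\mathcal F)]=3^{-13}$.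 -/

import Mathlib

open Filter Topology

namespace GuessingGame

/-! Guessing games on finite undirected graphs; every player sees the values of its neighbours. -/

/-- A (pure) strategy for the guessing game `(G, s)`: each player `v` guesses its own value as a
function of the values assigned to its neighbours. -/
abbrev Strategy {V : Type*} (G : SimpleGraph V) (s : ℕ) : Type _ :=
  (v : V) → (G.neighborSet v → Fin s) → Fin s

/-- The guess of player `v` under the strategy `F` when the assigned values are `a`. -/
def Strategy.guess {V : Type*} {G : SimpleGraph V} {s : ℕ} (F : Strategy G s)
    (a : V → Fin s) (v : V) : Fin s :=
  F v (fun u => a u)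

/-- The event that all players guess correctly. -/
def winSet {V : Type*} (G : SimpleGraph V) (s : ℕ) (F : Strategy G s) : Set (V → Fin s) :=
  {a | ∀ v, F.guess a v = a v}

/-- The probability of winning when the values are independent and uniform on `Fin s`. -/
noncomputable def winProb {V : Type*} [Fintype V] (G : SimpleGraph V) (s : ℕ)
    (F : Strategy G s) : ℝ :=
  ((winSet G s F).ncard : ℝ) / (s : ℝ) ^ Fintype.card V

/-- The guessing number `gn(G, s) = |V| + log_s (max_F P[Win(G, s, F)])`. There are only finitely
many strategies, and at least one if `s ≥ 1`, so that the supremum is then a maximum. -/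
noncomputable def guessingNumber {V : Type*} [Fintype V] (G : SimpleGraph V) (s : ℕ) : ℝ :=
  (Fintype.card V : ℝ) + Real.logb s (⨆ F : Strategy G s, winProb G s F)

/-- `g` is the asymptotic guessing number of `G`: the limit of `gn(G, s)` as `s → ∞` exists and
is equal to `g`. -/
def HasAsymptoticGuessingNumber {V : Type*} [Fintype V] (G : SimpleGraph V) (g : ℝ) : Prop :=
  Tendsto (fun s : ℕ => guessingNumber G s) atTop (𝓝 g)

/-- The `t`-uniform blowup of `G`. -/
def blowup {V : Type*} (G : SimpleGraph V) (t : ℕ) : SimpleGraph (V × Fin t) :=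
  G.comap Prod.fst

/-! Fractional clique covers. -/

/-- A fractional clique cover, as a function on all finite vertex sets that vanishes off the
cliques. -/
structure IsFractionalCliqueCover {V : Type*} [Fintype V] [DecidableEq V] (G : SimpleGraph V)
    (w : Finset V → ℝ) : Prop where
  mem_Icc : ∀ k, w k ∈ Set.Icc (0 : ℝ) 1
  eq_zero : ∀ k : Finset V, ¬ G.IsClique (k : Set V) → w k = 0
  covers : ∀ v, 1 ≤ ∑ k with v ∈ k, w k

/-- The total weights of the fractional clique covers of `G`. -/
def cliqueCoverWeights {V : Type*} [Fintype V] [DecidableEq V] (G : SimpleGraph V) : Set ℝ :=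
  {x | ∃ w, IsFractionalCliqueCover G w ∧ ∑ k, w k = x}

/-- The fractional clique cover number `κ_f(G)`. -/
noncomputable def fractionalCliqueCoverNumber {V : Type*} [Fintype V] [DecidableEq V]
    (G : SimpleGraph V) : ℝ :=
  sInf (cliqueCoverWeights G)

/-- The fractional clique cover bound `|V| - κ_f(G)`. -/
noncomputable def fractionalCliqueCoverBound {V : Type*} [Fintype V] [DecidableEq V]
    (G : SimpleGraph V) : ℝ :=
  (Fintype.card V : ℝ) - fractionalCliqueCoverNumber G

/-! The Shannon bound. -/

/-- The constraints of the linear program that defines the Shannon bound; `h X` stands for the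
joint entropy of the values assigned to the vertices in `X`. -/
structure IsShannonFeasible {V : Type*} [Fintype V] [DecidableEq V] (G : SimpleGraph V)
    (h : Finset V → ℝ) : Prop where
  nonneg : ∀ X, 0 ≤ h X
  le_card : ∀ X, h X ≤ X.card
  shannon : ∀ X Y Z, 0 ≤ h (X ∪ Z) + h (Y ∪ Z) - h (X ∪ Y ∪ Z) - h Z
  graph : ∀ A B : Finset V, (∀ u ∈ A, G.neighborSet u ⊆ (B : Set V)) → h (A ∪ B) = h B

/-- The values of the objective function `h V` on the feasible points; the Shannon bound `Sh(G)`
is the greatest of them. -/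
def shannonValues {V : Type*} [Fintype V] [DecidableEq V] (G : SimpleGraph V) : Set ℝ :=
  {x | ∃ h, IsShannonFeasible G h ∧ h Finset.univ = x}

/-- `x` is the Shannon bound of `G`. -/
def IsShannonBound {V : Type*} [Fintype V] [DecidableEq V] (G : SimpleGraph V) (x : ℝ) : Prop :=
  IsGreatest (shannonValues G) x

/-! The graphs `R` and `R_c`. -/

/-- The graph `R`. With vertices numbered `1, …, 10`, vertex `i` is represented by
`i - 1 : Fin 10`. The vertex `1` is joined to the hexagon `2 3 4 5 6 7`, the vertices
`8`, `9`, `10` form a triangle, and each of these sees four vertices of the hexagon. -/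
def graphR : SimpleGraph (Fin 10) :=
  SimpleGraph.fromRel fun i j => (i, j) ∈ ([
    (0, 1), (0, 2), (0, 3), (0, 4), (0, 5), (0, 6),
    (1, 2), (2, 3), (3, 4), (4, 5), (5, 6), (6, 1),
    (7, 2), (7, 3), (7, 5), (7, 6),
    (8, 1), (8, 2), (8, 4), (8, 5),
    (9, 1), (9, 3), (9, 4), (9, 6),
    (7, 8), (8, 9), (9, 7)] : List (Fin 10 × Fin 10))

/-- The vertices of `R_c` are `1, …, 10, 8', 9', 10'`, in this order; this is the map that sends
each to the vertex of `R` of which it is a copy. -/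
def cloneOf : Fin 13 → Fin 10 := ![0, 1, 2, 3, 4, 5, 6, 7, 8, 9, 7, 8, 9]

/-- The graph `R_c`, obtained from `R` by cloning the vertices `8`, `9`, `10`. -/
def graphRc : SimpleGraph (Fin 13) := graphR.comap cloneOf

/-- The four parity conditions `∑ w, rcCheck i w * a w = 0` in `ℤ/3`; the columns are
`1, 2, 3, 4, 5, 6, 7, 8, 9, 10, 8', 9', 10'`. -/
def rcCheck : Matrix (Fin 4) (Fin 13) (Fin 3) :=
  !![1, 1, 2, 1, 2, 1, 2, 0, 0, 0, 0, 0, 0;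
     0, 1, 0, 0, 1, 0, 0, 1, 1, 0, 1, 0, 1;
     0, 0, 1, 0, 0, 1, 0, 1, 0, 1, 0, 1, 1;
     0, 0, 0, 1, 0, 0, 1, 0, 1, 1, 1, 1, 0]

/-- Row `v` gives the linear combination of the four conditions that player `v` uses. -/
def rcComb : Matrix (Fin 13) (Fin 4) (Fin 3) :=
  !![1, 0, 0, 0;
     2, 2, 1, 1;
     1, 1, 2, 1;
     2, 1, 1, 2;
     1, 2, 1, 1;
     2, 1, 2, 1;
     1, 1, 1, 2;
     0, 0, 1, 0;
     0, 1, 0, 0;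
     0, 0, 0, 1;
     0, 0, 0, 1;
     0, 0, 1, 0;
     0, 1, 0, 0]

/-- The guess of player `v` in the `R_c` strategy: the combination of the conditions used by `v`
has coefficient `1` at `v`, and `v` guesses the value that makes it hold. -/
def rcGuess (a : Fin 13 → Fin 3) (v : Fin 13) : Fin 3 :=
  -∑ w with w ≠ v, (rcComb * rcCheck) v w * a w

end GuessingGame

open GuessingGame

/-!
Call a set of assignments of values to the vertices a *code* if on it the value of each vertex is a
function of the values of its neighbours. The winning set of a strategy is a code, and every code is
contained in a winning set. The joint entropies of a uniformly random codeword satisfy the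
constraints of the Shannon bound, so `gn(G, s)` never exceeds `Sh(G)`. Conversely, a code over one
alphabet can be repeated on as many blocks as fit into a larger alphabet. Hence, if the logarithm of
the size of a single code, to the base of the alphabet size, equals `Sh(G)`, then `gn(G, s)`
converges to `Sh(G)`.

For `R`, this code comes from the strategy on `R(4)`, which is linear over `ℤ/3`: all guesses are
correct if and only if nine triangle sums and four parity conditions vanish. The sums over disjoint
triangles are independent of the values on the copy of `R_c`, and the four conditions are
independent, so the strategy wins on `3 ^ (40 - 13) = 3 ^ 27` assignments, which form a code for `R`
over the alphabet `(ℤ/3)⁴`, and `27 / 4` is the logarithm of its size.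

To bound `Sh(R)` from above, average a feasible point over the automorphisms of `R`. Identifying
sets that lie in the same orbit, or have the same closure under "a vertex is determined by its
neighbours", leaves few variables, and `27 / 4` is a combination of submodularity inequalities whose
coefficients come from an optimal solution of the dual linear program.
-/

namespace GuessingGame

open scoped BigOperators Finset

/-! ### Entropy -/

section Entropy

variable {Ω α β γ : Type*} {S : Finset Ω}

theorem expect_log_nonpos {x : Ω → ℝ} (hpos : ∀ a ∈ S, 0 < x a) (hx : ∑ a ∈ S, x a ≤ #S) :
    𝔼 a ∈ S, Real.log (x a) ≤ 0 := by
  rw [Finset.expect_eq_sum_div_card]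
  refine div_nonpos_of_nonpos_of_nonneg ?_ (Nat.cast_nonneg _)
  calc ∑ a ∈ S, Real.log (x a) ≤ ∑ a ∈ S, (x a - 1) :=
        Finset.sum_le_sum fun a ha => Real.log_le_sub_one_of_pos (hpos a ha)
    _ = ∑ a ∈ S, x a - #S := by simp
    _ ≤ 0 := sub_nonpos.2 hx

variable [DecidableEq α] [DecidableEq β] [DecidableEq γ]

/-- The Shannon entropy, in nats, of the random variable `f` on the finite set `S` with the uniform
distribution, written as the expectation of the self-information of the value of `f`. -/
noncomputable def entropy (S : Finset Ω) (f : Ω → α) : ℝ :=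
  𝔼 a ∈ S, Real.log (#S / #{b ∈ S | f b = f a})

theorem card_fiber_pos (f : Ω → α) {a : Ω} (ha : a ∈ S) : (0 : ℝ) < #{b ∈ S | f b = f a} :=
  Nat.cast_pos.2 <| Finset.card_pos.2 ⟨a, Finset.mem_filter.2 ⟨ha, rfl⟩⟩

theorem sum_div_card_fiber (f : Ω → α) (φ : α → ℝ) :
    ∑ a ∈ S, φ (f a) / #{b ∈ S | f b = f a} = ∑ c ∈ S.image f, φ c := by
  refine (Finset.sum_image' _ fun a ha => ?_).symm
  have hconst : ∀ b ∈ S.filter (f · = f a),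
      φ (f b) / #{c ∈ S | f c = f b} = φ (f a) / #{c ∈ S | f c = f a} := fun b hb => by
    rw [(Finset.mem_filter.1 hb).2]
  rw [Finset.sum_congr rfl hconst, Finset.sum_const, nsmul_eq_mul,
    mul_div_cancel₀ _ (card_fiber_pos f ha).ne']

theorem entropy_nonneg (f : Ω → α) : 0 ≤ entropy S f :=
  Finset.expect_nonneg fun a ha => Real.log_nonneg <| by
    rw [one_le_div (card_fiber_pos f ha)]
    exact_mod_cast Finset.card_filter_le _ _

theorem entropy_congr {f : Ω → α} {g : Ω → β}
    (h : ∀ a ∈ S, ∀ b ∈ S, f b = f a ↔ g b = g a) : entropy S f = entropy S g :=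
  Finset.expect_congr rfl fun a ha => by rw [Finset.filter_congr (h a ha)]

theorem entropy_of_injOn {f : Ω → α} (hf : Set.InjOn f S) : entropy S f = Real.log #S := by
  rcases S.eq_empty_or_nonempty with rfl | hne
  · simp [entropy]
  have hfiber : ∀ a ∈ S, #{b ∈ S | f b = f a} = 1 := fun a ha =>
    Finset.card_eq_one.2 ⟨a, by grind [Set.InjOn]⟩
  rw [entropy, Finset.expect_congr rfl fun a ha => by rw [hfiber a ha, Nat.cast_one, div_one],
    Finset.expect_const hne]

theorem entropy_le_log_card_image (f : Ω → α) : entropy S f ≤ Real.log #(S.image f) := by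
  rcases S.eq_empty_or_nonempty with rfl | hne
  · simp [entropy]
  have hS : (0 : ℝ) < #S := Nat.cast_pos.2 hne.card_pos
  have himage : (0 : ℝ) < #(S.image f) := Nat.cast_pos.2 (hne.image f).card_pos
  have hsum : ∑ a ∈ S, #S / #(S.image f) / (#{b ∈ S | f b = f a} : ℝ) = #S := by
    rw [sum_div_card_fiber f fun _ => (#S / #(S.image f) : ℝ), Finset.sum_const, nsmul_eq_mul,
      mul_div_cancel₀ _ himage.ne']
  have hlog : entropy S f - Real.log #(S.image f) =
      𝔼 a ∈ S, Real.log (#S / #(S.image f) / #{b ∈ S | f b = f a}) := by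
    rw [entropy, ← Finset.expect_const hne (Real.log #(S.image f)), ← Finset.expect_sub_distrib]
    refine Finset.expect_congr rfl fun a ha => ?_
    have := card_fiber_pos f ha
    rw [← Real.log_div (by positivity) himage.ne', div_right_comm]
  rw [← sub_nonpos, hlog]
  exact expect_log_nonpos
    (fun a ha => div_pos (div_pos hS himage) (card_fiber_pos f ha)) hsum.le

theorem sum_card_joint_fiber (f : Ω → α) (k : Ω → γ) (z : γ) :
    ∑ x ∈ S.image f, (#{b ∈ S | (f b, k b) = (x, z)} : ℝ) = #{b ∈ S | k b = z} := by
  rw [Finset.card_eq_sum_card_fiberwise (f := f) (t := S.image f) fun a ha =>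
    Finset.mem_coe.2 (Finset.mem_image_of_mem f (Finset.mem_filter.1 ha).1), Nat.cast_sum]
  simp only [Finset.filter_filter, Prod.mk.injEq, and_comm]

/-- Replacing the joint distribution of `f`, `g` and `k` by the one in which `f` and `g` are
independent given `k`, the total mass is at most `1` on the support of the former. -/
theorem sum_card_fiber_mul_card_fiber_div_le (f : Ω → α) (g : Ω → β) (k : Ω → γ) :
    ∑ c ∈ S.image fun a => (f a, g a, k a),
      (#{b ∈ S | (f b, k b) = (c.1, c.2.2)} * #{b ∈ S | (g b, k b) = c.2} : ℝ) /
        #{b ∈ S | k b = c.2.2} ≤ #S := by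
  have hsub : (S.image fun a => (f a, g a, k a)) ⊆ S.image f ×ˢ S.image g ×ˢ S.image k :=
    Finset.image_subset_iff.2 fun a ha => by
      simp only [Finset.mem_product, Finset.mem_image_of_mem _ ha, and_self]
  calc _ ≤ ∑ c ∈ S.image f ×ˢ S.image g ×ˢ S.image k,
        (#{b ∈ S | (f b, k b) = (c.1, c.2.2)} * #{b ∈ S | (g b, k b) = c.2} : ℝ) /
          #{b ∈ S | k b = c.2.2} :=
        Finset.sum_le_sum_of_subset_of_nonneg hsub fun _ _ _ => by positivity
    _ = ∑ z ∈ S.image k, (∑ x ∈ S.image f, (#{b ∈ S | (f b, k b) = (x, z)} : ℝ)) *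
          (∑ y ∈ S.image g, (#{b ∈ S | (g b, k b) = (y, z)} : ℝ)) / #{b ∈ S | k b = z} := by
        simp only [Finset.sum_product, Finset.sum_mul_sum, Finset.sum_div]
        rw [Finset.sum_comm_cycle]
    _ = ∑ z ∈ S.image k, (#{b ∈ S | k b = z} : ℝ) := by
        simp only [sum_card_joint_fiber, mul_self_div_self]
    _ = #S := by
        rw [Finset.card_eq_sum_card_image k S, Nat.cast_sum]

theorem entropy_submodular (f : Ω → α) (g : Ω → β) (k : Ω → γ) :
    entropy S (fun a => (f a, g a, k a)) + entropy S k ≤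
      entropy S (fun a => (f a, k a)) + entropy S fun a => (g a, k a) := by
  set ratio : Ω → ℝ := fun a =>
    #{b ∈ S | (f b, k b) = (f a, k a)} * #{b ∈ S | (g b, k b) = (g a, k a)} /
      #{b ∈ S | k b = k a} / #{b ∈ S | (f b, g b, k b) = (f a, g a, k a)} with hratio
  have hpos : ∀ a ∈ S, 0 < ratio a := fun a ha =>
    div_pos (div_pos (mul_pos (card_fiber_pos (fun a => (f a, k a)) ha)
      (card_fiber_pos (fun a => (g a, k a)) ha)) (card_fiber_pos k ha))
      (card_fiber_pos (fun a => (f a, g a, k a)) ha)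
  have hsum : ∑ a ∈ S, ratio a ≤ #S := by
    rw [hratio, sum_div_card_fiber (fun a => (f a, g a, k a)) fun c : α × β × γ =>
      (#{b ∈ S | (f b, k b) = (c.1, c.2.2)} * #{b ∈ S | (g b, k b) = c.2} : ℝ) /
        #{b ∈ S | k b = c.2.2}]
    exact sum_card_fiber_mul_card_fiber_div_le f g k
  rw [← sub_nonpos]
  refine (Eq.trans_le ?_ (expect_log_nonpos hpos hsum))
  simp only [entropy, ← Finset.expect_sub_distrib, ← Finset.expect_add_distrib]
  refine Finset.expect_congr rfl fun a ha => ?_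
  have hS : (#S : ℝ) ≠ 0 := Nat.cast_ne_zero.2 (Finset.card_ne_zero_of_mem ha)
  have hk := (card_fiber_pos k ha).ne'
  have hfk := (card_fiber_pos (fun a => (f a, k a)) ha).ne'
  have hgk := (card_fiber_pos (fun a => (g a, k a)) ha).ne'
  have hfgk := (card_fiber_pos (fun a => (f a, g a, k a)) ha).ne'
  simp only [hratio]
  rw [Real.log_div hS hfgk, Real.log_div hS hk, Real.log_div hS hfk, Real.log_div hS hgk,
    Real.log_div (by positivity) hfgk, Real.log_div (by positivity) hk, Real.log_mul hfk hgk]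
  ring

end Entropy

/-! ### Codes on graphs -/

section Code

variable {V α β : Type*} {G : SimpleGraph V} {S : Set (V → α)}

/-- A set of assignments of values to the vertices of `G` on which the value of each vertex is
determined by the values of its neighbours. For values in `Fin s`, these are the sets of
assignments on which some strategy wins. -/
def IsCode (G : SimpleGraph V) (S : Set (V → α)) : Prop :=
  ∀ a ∈ S, ∀ b ∈ S, ∀ v, (∀ u, G.Adj v u → a u = b u) → a v = b v

theorem isCode_winSet {s : ℕ} (F : Strategy G s) : IsCode G (winSet G s F) := by
  intro a ha b hb v h
  rw [← ha v, ← hb v]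
  exact congrArg (F v) (funext fun u => h u u.2)

theorem exists_strategy_guess_eq {s : ℕ} [NeZero s] {S : Set (V → Fin s)}
    (g : (V → Fin s) → V → Fin s)
    (hg : ∀ a ∈ S, ∀ b ∈ S, ∀ v, (∀ u, G.Adj v u → a u = b u) → g a v = g b v) :
    ∃ F : Strategy G s, ∀ a ∈ S, ∀ v, F.guess a v = g a v := by
  refine ⟨fun v => Function.extend (fun (a : S) (u : G.neighborSet v) => a.1 u)
    (fun a => g a v) fun _ => 0, fun a ha v => ?_⟩
  have hfactors : Function.FactorsThrough (fun a : S => g a.1 v)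
      fun (a : S) (u : G.neighborSet v) => a.1 u := fun b c h =>
    hg b b.2 c c.2 v fun u hu => congrFun h ⟨u, hu⟩
  exact hfactors.extend_apply (fun _ => 0) ⟨a, ha⟩

theorem IsCode.exists_subset_winSet {s : ℕ} [NeZero s] {S : Set (V → Fin s)} (hS : IsCode G S) :
    ∃ F : Strategy G s, S ⊆ winSet G s F :=
  exists_strategy_guess_eq id hS

theorem IsCode.exists_ncard_eq_pow {ι : Type*} [Finite ι] (hS : IsCode G S) (e : (ι → α) ↪ β) :
    ∃ T : Set (V → β), IsCode G T ∧ T.ncard = S.ncard ^ Nat.card ι := by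
  let combine : (ι → S) → V → β := fun a v => e fun i => (a i).1 v
  have hcombine : Function.Injective combine := fun a b h =>
    funext fun i => Subtype.ext <| funext fun v => congrFun (e.injective (congrFun h v)) i
  refine ⟨Set.range combine, ?_, ?_⟩
  · rintro _ ⟨a, rfl⟩ _ ⟨b, rfl⟩ v h
    exact congrArg e <| funext fun i =>
      hS _ (a i).2 _ (b i).2 v fun u hu => congrFun (e.injective (h u hu)) i
  · rw [← Nat.card_coe_set_eq, Nat.card_range_of_injective hcombine, Nat.card_fun,
      Nat.card_coe_set_eq]

theorem IsCode.image_curry {t : ℕ} {S : Set (V × Fin t → α)} (hS : IsCode (blowup G t) S) :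
    IsCode G (Function.curry '' S) := by
  rintro _ ⟨a, ha, rfl⟩ _ ⟨b, hb, rfl⟩ v h
  exact funext fun i => hS a ha b hb (v, i) fun u hu => congrFun (h u.1 hu) u.2

theorem IsCode.isShannonFeasible [Fintype V] [DecidableEq V] [Fintype α] [DecidableEq α]
    {S : Finset (V → α)} (hS : IsCode G (S : Set (V → α))) :
    IsShannonFeasible G fun X => entropy S X.restrict / Real.log (Fintype.card α) where
  nonneg X := div_nonneg (entropy_nonneg _) (Real.log_natCast_nonneg _)
  le_card X := by
    refine div_le_of_le_mul₀ (Real.log_natCast_nonneg _) (Nat.cast_nonneg _) ?_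
    rcases S.eq_empty_or_nonempty with rfl | hne
    · simpa [entropy] using mul_nonneg (Nat.cast_nonneg _) (Real.log_natCast_nonneg _)
    calc entropy S X.restrict ≤ Real.log #(S.image X.restrict) := entropy_le_log_card_image _
      _ ≤ Real.log (Fintype.card (X → α)) :=
        Real.log_le_log (Nat.cast_pos.2 (hne.image _).card_pos)
          (Nat.cast_le.2 (Finset.card_le_univ _))
      _ = #X * Real.log (Fintype.card α) := by simp
  shannon X Y Z := by
    have hpair : ∀ A B : Finset V, entropy S (A ∪ B).restrict =
        entropy S fun a => (A.restrict a, B.restrict a) := fun A B =>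
      entropy_congr fun a _ b _ => by
        simp only [funext_iff, Finset.restrict, Subtype.forall, Prod.mk.injEq, Finset.mem_union,
          or_imp, forall_and]
    have htriple : entropy S (X ∪ Y ∪ Z).restrict =
        entropy S fun a => (X.restrict a, Y.restrict a, Z.restrict a) :=
      entropy_congr fun a _ b _ => by
        simp only [funext_iff, Finset.restrict, Subtype.forall, Prod.mk.injEq, Finset.mem_union,
          or_imp, forall_and, and_assoc]
    have hsub := entropy_submodular (S := S) (X.restrict (π := fun _ => α)) Y.restrict Z.restrict
    rw [← add_div, ← sub_div, ← sub_div, hpair, hpair, htriple]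
    exact div_nonneg (by linarith) (Real.log_natCast_nonneg _)
  graph A B hAB := by
    congr 1
    refine entropy_congr fun a ha b hb => ?_
    simp only [funext_iff, Finset.restrict, Subtype.forall, Finset.mem_union, or_imp, forall_and,
      and_iff_right_iff_imp]
    exact fun h v hv => hS b hb a ha v fun u hu => h u (hAB v hv hu)

variable [Fintype V]

theorem IsCode.logb_ncard_mem_shannonValues [DecidableEq V] [Fintype α] (hS : IsCode G S) :
    Real.logb (Fintype.card α) S.ncard ∈ shannonValues G := by
  classical
  rw [← Set.coe_toFinset S] at hS
  refine ⟨_, hS.isShannonFeasible, ?_⟩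
  have hinj : Set.InjOn (Finset.univ.restrict : (V → α) → _) S.toFinset := fun a _ b _ h =>
    funext fun v => congrFun h ⟨v, Finset.mem_univ v⟩
  simp only [entropy_of_injOn hinj, Set.ncard_eq_toFinset_card', Real.log_div_log]

section GuessingNumber

variable {s : ℕ}

theorem add_logb_winProb (hs : 1 < s) {F : Strategy G s} (hF : (winSet G s F).Nonempty) :
    Fintype.card V + Real.logb s (winProb G s F) = Real.logb s (winSet G s F).ncard := by
  have hs' : (1 : ℝ) < s := Nat.one_lt_cast.2 hs
  have hpos : ((winSet G s F).ncard : ℝ) ≠ 0 :=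
    Nat.cast_ne_zero.2 <| Set.ncard_ne_zero_of_mem hF.some_mem
  rw [winProb, Real.logb_div hpos (by positivity), Real.logb_pow, Real.logb_self_eq_one hs',
    mul_one, add_sub_cancel]

theorem logb_ncard_image_curry_winSet (hs : 1 < s) {t : ℕ} {F : Strategy (blowup G t) s}
    (hF : (winSet (blowup G t) s F).Nonempty) :
    Real.logb (Fintype.card (Fin t → Fin s)) (Function.curry '' winSet (blowup G t) s F).ncard =
      (Fintype.card (V × Fin t) + Real.logb s (winProb (blowup G t) s F)) / t := by
  rw [add_logb_winProb hs hF, Set.ncard_image_of_injective _ Function.curry_injective,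
    Fintype.card_fun, Fintype.card_fin, Fintype.card_fin, Nat.cast_pow, Real.logb, Real.log_pow,
    Real.logb, div_div, mul_comm]

theorem winProb_pos (hs : 0 < s) {F : Strategy G s} (hF : (winSet G s F).Nonempty) :
    0 < winProb G s F :=
  div_pos (Nat.cast_pos.2 <| (Set.ncard_pos).2 hF) (pow_pos (Nat.cast_pos.2 hs) _)

theorem IsCode.logb_ncard_le_guessingNumber (hs : 1 < s) {S : Set (V → Fin s)}
    (hS : IsCode G S) (hne : S.Nonempty) : Real.logb s S.ncard ≤ guessingNumber G s := by
  have : NeZero s := ⟨by lia⟩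
  have hs' : (1 : ℝ) < s := Nat.one_lt_cast.2 hs
  obtain ⟨F, hF⟩ := hS.exists_subset_winSet
  calc Real.logb s S.ncard ≤ Real.logb s (winSet G s F).ncard :=
        Real.logb_le_logb_of_le hs' (Nat.cast_pos.2 <| (Set.ncard_pos).2 hne)
          (Nat.cast_le.2 <| Set.ncard_le_ncard hF)
    _ = Fintype.card V + Real.logb s (winProb G s F) := (add_logb_winProb hs (hne.mono hF)).symm
    _ ≤ guessingNumber G s := add_le_add_right
        (Real.logb_le_logb_of_le hs' (winProb_pos (by lia) (hne.mono hF))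
          (le_ciSup (Set.finite_range (winProb G s)).bddAbove F)) _

theorem exists_guessingNumber_eq_logb_ncard (hs : 1 < s) (G : SimpleGraph V) :
    ∃ F : Strategy G s, guessingNumber G s = Real.logb s (winSet G s F).ncard := by
  have : NeZero s := ⟨by lia⟩
  have hzero : (winSet G s fun _ _ => 0).Nonempty := ⟨fun _ => 0, fun _ => rfl⟩
  obtain ⟨F, hF⟩ := exists_eq_ciSup_of_finite (f := winProb G s)
  have hpos : 0 < winProb G s F := (winProb_pos (by lia) hzero).trans_le <|
    (le_ciSup (Set.finite_range (winProb G s)).bddAbove _).trans_eq hF.symm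
  have hne : (winSet G s F).Nonempty := Set.nonempty_iff_ne_empty.2 fun h => by
    simp [winProb, h] at hpos
  exact ⟨F, by rw [guessingNumber, ← hF, add_logb_winProb hs hne]⟩

theorem guessingNumber_mem_shannonValues [DecidableEq V] (hs : 1 < s) (G : SimpleGraph V) :
    guessingNumber G s ∈ shannonValues G := by
  obtain ⟨F, hF⟩ := exists_guessingNumber_eq_logb_ncard hs G
  simpa only [hF, Fintype.card_fin] using (isCode_winSet F).logb_ncard_mem_shannonValues

variable [Fintype α]

/-- Use the code independently on as many blocks as fit into the alphabet `Fin s`. -/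
theorem IsCode.natLog_mul_logb_ncard_le_guessingNumber (hS : IsCode G S) (hne : S.Nonempty)
    (hα : 1 < Fintype.card α) (hs : 1 < s) :
    Nat.log (Fintype.card α) s / Real.logb (Fintype.card α) s *
      Real.logb (Fintype.card α) S.ncard ≤ guessingNumber G s := by
  set q := Fintype.card α
  have hle : Fintype.card (Fin (Nat.log q s) → α) ≤ Fintype.card (Fin s) := by
    simpa using Nat.pow_log_le_self q (by lia)
  obtain ⟨T, hT, hcard⟩ := hS.exists_ncard_eq_pow (Function.Embedding.nonempty_of_card_le hle).some
  have hTne : T.Nonempty := (Set.ncard_pos).1 <| hcard ▸ pow_pos ((Set.ncard_pos).2 hne) _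
  refine le_of_eq_of_le ?_ (hT.logb_ncard_le_guessingNumber hs hTne)
  rw [hcard, Nat.card_fin, Nat.cast_pow, Real.logb_pow, div_eq_mul_inv, Real.inv_logb, mul_assoc,
    Real.mul_logb] <;> norm_cast <;> lia

theorem tendsto_natLog_div_logb {q : ℕ} (hq : 1 < q) :
    Tendsto (fun s : ℕ => (Nat.log q s : ℝ) / Real.logb q s) atTop (𝓝 1) := by
  have hlog : Tendsto (fun s : ℕ => Real.logb q s) atTop atTop :=
    (Real.tendsto_logb_atTop (Nat.one_lt_cast.2 hq)).comp tendsto_natCast_atTop_atTop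
  simpa only [Function.comp_def, Real.natFloor_logb_natCast] using
    (tendsto_nat_floor_div_atTop (R := ℝ)).comp hlog

theorem IsCode.hasAsymptoticGuessingNumber [DecidableEq V] (hS : IsCode G S) (hne : S.Nonempty)
    (hα : 1 < Fintype.card α)
    (hG : Real.logb (Fintype.card α) S.ncard ∈ upperBounds (shannonValues G)) :
    HasAsymptoticGuessingNumber G (Real.logb (Fintype.card α) S.ncard) := by
  have hlim := (tendsto_natLog_div_logb hα).mul_const (Real.logb (Fintype.card α) S.ncard)
  rw [one_mul] at hlim
  refine tendsto_of_tendsto_of_tendsto_of_le_of_le' hlim tendsto_const_nhds ?_ ?_ <;>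
    filter_upwards [eventually_gt_atTop 1] with s hs
  · exact hS.natLog_mul_logb_ncard_le_guessingNumber hne hα hs
  · exact hG (guessingNumber_mem_shannonValues hs G)

end GuessingNumber

end Code

/-! ### The Shannon bound -/

section ShannonFeasible

variable {V : Type*} [Fintype V] [DecidableEq V] {G : SimpleGraph V} {h : Finset V → ℝ}

theorem IsShannonFeasible.submodular (hh : IsShannonFeasible G h) (X Y : Finset V) :
    h (X ∪ Y) + h (X ∩ Y) ≤ h X + h Y := by
  have := hh.shannon X Y (X ∩ Y)
  rw [Finset.union_eq_left.2 Finset.inter_subset_left,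
    Finset.union_eq_left.2 Finset.inter_subset_right,
    Finset.union_eq_left.2 (Finset.inter_subset_left.trans Finset.subset_union_left)] at this
  linarith

theorem IsShannonFeasible.map_empty (hh : IsShannonFeasible G h) : h ∅ = 0 :=
  le_antisymm (by simpa using hh.le_card ∅) (hh.nonneg ∅)

theorem IsShannonFeasible.comp_map (hh : IsShannonFeasible G h) (g : G ≃g G) :
    IsShannonFeasible G fun X => h (X.map g.toEquiv.toEmbedding) where
  nonneg X := hh.nonneg _
  le_card X := (hh.le_card _).trans_eq (by rw [Finset.card_map])
  shannon X Y Z := by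
    simp only [Finset.map_union]
    exact hh.shannon _ _ _
  graph A B hAB := by
    rw [Finset.map_union]
    refine hh.graph _ _ fun u hu w hw => ?_
    obtain ⟨x, hx, rfl⟩ := Finset.mem_map.1 hu
    have hadj : G.Adj x (g.symm w) := by
      rw [← g.map_rel_iff, RelIso.apply_symm_apply]
      exact hw
    exact Finset.mem_map.2 ⟨g.symm w, hAB x hx hadj, g.apply_symm_apply w⟩

theorem IsShannonFeasible.expect {ι : Type*} [Fintype ι] [Nonempty ι] {f : ι → Finset V → ℝ}
    (hf : ∀ i, IsShannonFeasible G (f i)) : IsShannonFeasible G fun X => 𝔼 i, f i X where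
  nonneg X := Finset.expect_nonneg fun i _ => (hf i).nonneg X
  le_card X := Finset.expect_le Finset.univ_nonempty fun i _ => (hf i).le_card X
  shannon X Y Z := by
    simp only [← Finset.expect_add_distrib, ← Finset.expect_sub_distrib]
    exact Finset.expect_nonneg fun i _ => (hf i).shannon X Y Z
  graph A B hAB := Finset.expect_congr rfl fun i _ => (hf i).graph A B hAB

/-- Averaging over the automorphism group. -/
theorem IsShannonFeasible.exists_invariant (hh : IsShannonFeasible G h) :
    ∃ h', IsShannonFeasible G h' ∧ h' Finset.univ = h Finset.univ ∧
      ∀ (g : G ≃g G) (X : Finset V), h' (X.map g.toEquiv.toEmbedding) = h' X := by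
  have : Finite (G ≃g G) := Finite.of_injective _ RelIso.toEquiv_injective
  have := Fintype.ofFinite (G ≃g G)
  refine ⟨_, IsShannonFeasible.expect fun g : G ≃g G => hh.comp_map g, ?_, fun g X => ?_⟩
  · simp only [Finset.map_univ_equiv, Fintype.expect_const]
  · refine Fintype.expect_equiv (Equiv.mulRight g) _ _ fun f => ?_
    rw [Finset.map_map]
    rfl

variable [DecidableRel G.Adj]

/-- The vertices that lie in `X` or have all their neighbours in `X`: these are the vertices whose
values are determined by the values on `X`. -/
def determinedBy (G : SimpleGraph V) [DecidableRel G.Adj] (X : Finset V) : Finset V :=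
  ({u | ∀ v, G.Adj u v → v ∈ X} : Finset V) ∪ X

theorem IsShannonFeasible.map_determinedBy (hh : IsShannonFeasible G h) (X : Finset V) :
    h (determinedBy G X) = h X :=
  hh.graph _ _ fun _ hu v hv => (Finset.mem_filter.1 hu).2 v hv

end ShannonFeasible

section ShannonBoundR

instance : DecidableRel graphR.Adj := fun i j =>
  decidable_of_iff _ (SimpleGraph.fromRel_adj _ i j).symm

/-- The automorphism of `R` that rotates the hexagon `1, …, 6`. -/
def rotationR : graphR ≃g graphR where
  toFun := ![0, 2, 3, 4, 5, 6, 1, 9, 7, 8]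
  invFun := ![0, 6, 1, 2, 3, 4, 5, 8, 9, 7]
  left_inv := by decide
  right_inv := by decide
  map_rel_iff' := by decide +kernel +revert

/-- The automorphism of `R` that reflects the hexagon `1, …, 6` in its diagonal through `1`. -/
def reflectionR : graphR ≃g graphR where
  toFun := ![0, 1, 6, 5, 4, 3, 2, 7, 9, 8]
  invFun := ![0, 1, 6, 5, 4, 3, 2, 7, 9, 8]
  left_inv := by decide
  right_inv := by decide
  map_rel_iff' := by decide +kernel +revert

/-- Two sets of vertices of `R` are alike if a symmetry of the hexagon takes the first to a set that
determines the same vertices as the second. -/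
def Alike (X Y : Finset (Fin 10)) : Prop :=
  ∃ (i : Fin 6) (j : Fin 2),
    determinedBy graphR
      (X.map (rotationR ^ (i : ℕ) * reflectionR ^ (j : ℕ)).toEquiv.toEmbedding) =
    determinedBy graphR Y

instance : DecidableRel Alike := fun X Y => by
  unfold Alike
  infer_instance

variable {h : Finset (Fin 10) → ℝ} (hh : IsShannonFeasible graphR h)
  (hinv : ∀ (g : graphR ≃g graphR) (X : Finset (Fin 10)), h (X.map g.toEquiv.toEmbedding) = h X)

include hh hinv

theorem eq_of_alike {X Y : Finset (Fin 10)} (hXY : Alike X Y) : h X = h Y := by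
  obtain ⟨i, j, hij⟩ := hXY
  rw [← hinv (rotationR ^ (i : ℕ) * reflectionR ^ (j : ℕ)), ← hh.map_determinedBy, hij,
    hh.map_determinedBy]

theorem submodular_of_alike (X Y : Finset (Fin 10)) {X' Y' U I : Finset (Fin 10)}
    (halike : Alike (X ∪ Y) U ∧ Alike (X ∩ Y) I ∧ Alike X X' ∧ Alike Y Y') :
    h U + h I ≤ h X' + h Y' := by
  obtain ⟨hU, hI, hX, hY⟩ := halike
  rw [← eq_of_alike hh hinv hU, ← eq_of_alike hh hinv hI, ← eq_of_alike hh hinv hX,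
    ← eq_of_alike hh hinv hY]
  exact hh.submodular X Y

/-- The diamond is `{0, 2, 3, 7}`, two triangles with a common edge. -/
theorem univ_add_le_two_mul_diamond :
    h .univ + h {0, 1, 2, 3, 4, 5, 6, 7} + h {0, 1, 2, 3, 7, 8} ≤
      h {7, 8} + 9 + 2 * h {0, 2, 3, 7} := by
  have hsub := submodular_of_alike hh hinv
  have h₁ : h .univ + h ∅ ≤ h {0, 1, 2, 4, 5} + h {7, 8} :=
    hsub {0, 1, 2, 4, 5} {7, 9} (by decide +kernel)
  have h₂ : h {0, 1, 2, 3, 4, 5, 6, 7} + h {0, 1, 2, 4, 5} ≤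
      h {1, 2, 3, 4, 5, 6} + h {0, 2, 3, 5, 6, 7} :=
    hsub {0, 1, 2, 3, 4, 5, 6} {0, 2, 3, 5, 6, 7} (by decide +kernel)
  have h₃ : h {0, 1, 2, 3, 7, 8} + h ∅ ≤ h {0, 7} + h {1, 3, 8} :=
    hsub {0, 7} {1, 3, 8} (by decide +kernel)
  have h₄ : h {0, 2, 3, 5, 6, 7} + h {0, 7} ≤ h {0, 2, 3, 7} + h {0, 2, 3, 7} :=
    hsub {0, 2, 3, 7} {0, 5, 6, 7} (by decide +kernel)
  have hhexagon : h {1, 2, 3, 4, 5, 6} ≤ 6 := hh.le_card _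
  have hthree : h {1, 3, 8} ≤ 3 := hh.le_card _
  linarith [hh.map_empty]

theorem three_mul_univ_add_two_mul_diamond_le :
    3 * h .univ + 2 * h {0, 2, 3, 7} + h {0, 2, 3, 4, 7, 8} ≤
      h {0, 1, 2, 3, 4, 5, 6, 7} + h {0, 1, 2, 3, 4, 5, 7, 8} + 4 * h {0, 1, 2, 3, 7, 8} := by
  have hsub := submodular_of_alike hh hinv
  have h₁ : h {0, 2, 3, 4, 7, 8} + h {0, 2, 3, 7} ≤ h {0, 1, 2, 3, 7} + h {0, 2, 3, 7, 8} :=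
    hsub {0, 1, 2, 3, 7} {0, 2, 3, 7, 9} (by decide +kernel)
  have h₂ : h .univ + h {0, 1, 2, 3, 7} ≤ h {0, 1, 2, 3, 4, 5, 7} + h {0, 1, 2, 3, 7, 8} :=
    hsub {0, 1, 2, 3, 4, 5, 7} {0, 2, 3, 4, 7, 9} (by decide +kernel)
  have h₃ : h .univ + h {0, 1, 2, 3, 4, 5, 7} ≤
      h {0, 1, 2, 3, 4, 5, 6, 7} + h {0, 1, 2, 3, 4, 5, 7, 8} :=
    hsub {0, 1, 2, 3, 4, 5, 6, 7} {0, 1, 2, 3, 4, 5, 7, 8} (by decide +kernel)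
  have h₄ : h {0, 1, 2, 3, 4, 7, 8, 9} + h {0, 2, 3, 7} ≤
      h {0, 1, 2, 3, 7, 8} + h {0, 1, 2, 3, 7, 8} :=
    hsub {0, 1, 2, 3, 7, 8} {0, 2, 3, 4, 7, 9} (by decide +kernel)
  have h₅ : h .univ + h {0, 2, 3, 7, 8} ≤ h {0, 1, 2, 3, 7, 8} + h {0, 1, 2, 3, 4, 7, 8, 9} :=
    hsub {0, 1, 2, 3, 7, 8} {0, 2, 3, 4, 5, 7, 8, 9} (by decide +kernel)
  linarith

theorem two_mul_add_edge_le :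
    2 * h {0, 1, 2, 3, 4, 5, 7, 8} + h {7, 8} ≤ 4 + 2 * h {0, 2, 3, 4, 7, 8} := by
  have hsub := submodular_of_alike hh hinv
  have h₁ : h {0, 1, 2, 3, 4, 5, 7, 8} + h {7, 8} ≤ h {1, 7, 8} + h {0, 2, 3, 4, 7, 8} :=
    hsub {1, 7, 8} {0, 3, 4, 5, 7, 8} (by decide +kernel)
  have h₂ : h {0, 1, 2, 3, 4, 5, 7, 8} + h {1, 7, 8} ≤ h {1, 4, 7, 8} + h {0, 2, 3, 4, 7, 8} :=
    hsub {1, 4, 7, 8} {0, 3, 4, 5, 7, 8} (by decide +kernel)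
  have hfour : h {1, 4, 7, 8} ≤ 4 := hh.le_card _
  linarith

theorem univ_le_of_invariant : h .univ ≤ 27 / 4 := by
  have hfive : h {0, 1, 2, 3, 7, 8} ≤ 5 := by
    rw [← eq_of_alike hh hinv (X := {0, 1, 3, 7, 8}) (by decide +kernel)]
    exact hh.le_card _
  have htwo : h {7, 8} ≤ 2 := hh.le_card _
  linarith [univ_add_le_two_mul_diamond hh hinv, three_mul_univ_add_two_mul_diamond_le hh hinv,
    two_mul_add_edge_le hh hinv]

end ShannonBoundR

theorem mem_upperBounds_shannonValues_graphR :
    (27 / 4 : ℝ) ∈ upperBounds (shannonValues graphR) := by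
  rintro _ ⟨h, hh, rfl⟩
  obtain ⟨h', hh', huniv, hinv⟩ := hh.exists_invariant
  exact huniv ▸ univ_le_of_invariant hh' hinv

/-! ### Fractional clique covers -/

section FractionalCliqueCover

variable {V : Type*} [Fintype V] [DecidableEq V] {G : SimpleGraph V} {r : ℕ}

/-- Count the pairs of a vertex and a clique that contains it in two ways. -/
theorem IsFractionalCliqueCover.card_le_mul_sum {w : Finset V → ℝ}
    (hw : IsFractionalCliqueCover G w) (hfree : G.CliqueFree (r + 1)) :
    Fintype.card V ≤ r * ∑ k, w k := by
  have hcard : ∀ k : Finset V, G.IsClique (k : Set V) → #k ≤ r := fun k hk => by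
    by_contra! hlt
    obtain ⟨l, hlk, hl⟩ := Finset.exists_subset_card_eq (Nat.succ_le_of_lt hlt)
    exact hfree l ⟨hk.subset (Finset.coe_subset.2 hlk), hl⟩
  calc (Fintype.card V : ℝ) ≤ ∑ v, ∑ k with v ∈ k, w k := by
        simpa using Finset.card_nsmul_le_sum Finset.univ _ (1 : ℝ) fun v _ => hw.covers v
    _ = ∑ k, #k * w k := by
        simp only [Finset.sum_filter]
        rw [Finset.sum_comm]
        simp only [Finset.sum_ite_mem, Finset.univ_inter, Finset.sum_const, nsmul_eq_mul]
    _ ≤ ∑ k, r * w k := Finset.sum_le_sum fun k _ => by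
        by_cases hk : G.IsClique (k : Set V)
        · exact mul_le_mul_of_nonneg_right (Nat.cast_le.2 (hcard k hk)) (hw.mem_Icc k).1
        · simp only [hw.eq_zero k hk, mul_zero, le_refl]
    _ = r * ∑ k, w k := (Finset.mul_sum ..).symm

theorem card_div_mem_cliqueCoverWeights (hr : 0 < r) {𝒯 : Finset (Finset V)}
    (hclique : ∀ k ∈ 𝒯, G.IsClique (k : Set V)) (hcover : ∀ v, r ≤ #{k ∈ 𝒯 | v ∈ k}) :
    (#𝒯 / r : ℝ) ∈ cliqueCoverWeights G := by
  have hr' : (1 : ℝ) ≤ r := Nat.one_le_cast.2 hr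
  have hsum : ∀ 𝒮 : Finset (Finset V),
      ∑ k ∈ 𝒮, (if k ∈ 𝒯 then (r : ℝ)⁻¹ else 0) = #(𝒮 ∩ 𝒯) / r := fun 𝒮 => by
    rw [Finset.sum_ite_mem, Finset.sum_const, nsmul_eq_mul, div_eq_mul_inv]
  refine ⟨fun k => if k ∈ 𝒯 then (r : ℝ)⁻¹ else 0, ⟨fun k => ?_, fun k hk => ?_, fun v => ?_⟩, ?_⟩
  · split_ifs
    · exact ⟨by positivity, inv_le_one_of_one_le₀ hr'⟩
    · exact ⟨le_rfl, zero_le_one⟩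
  · exact if_neg fun hmem => hk (hclique k hmem)
  · rw [hsum, one_le_div (by positivity), Finset.filter_inter, Finset.univ_inter]
    exact Nat.cast_le.2 (hcover v)
  · rw [hsum, Finset.univ_inter]

theorem isLeast_cliqueCoverWeights (hr : 0 < r) (hfree : G.CliqueFree (r + 1))
    {𝒯 : Finset (Finset V)} (hclique : ∀ k ∈ 𝒯, G.IsClique (k : Set V))
    (hcover : ∀ v, r ≤ #{k ∈ 𝒯 | v ∈ k}) (hcard : #𝒯 = Fintype.card V) :
    IsLeast (cliqueCoverWeights G) (Fintype.card V / r) := by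
  refine ⟨hcard ▸ card_div_mem_cliqueCoverWeights hr hclique hcover, ?_⟩
  rintro _ ⟨w, hw, rfl⟩
  exact div_le_of_le_mul₀ (Nat.cast_nonneg _)
    (Finset.sum_nonneg fun k _ => (hw.mem_Icc k).1) (by linarith [hw.card_le_mul_sum hfree])

/-- Ten triangles of `R` such that each vertex lies in exactly three of them. -/
def trianglesR : Finset (Finset (Fin 10)) :=
  {{0, 1, 2}, {0, 3, 4}, {0, 5, 6}, {7, 8, 9}, {2, 3, 7}, {5, 6, 7}, {1, 2, 8}, {4, 5, 8},
    {3, 4, 9}, {1, 6, 9}}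

theorem cliqueFree_four_graphR : graphR.CliqueFree 4 := by
  have hfour : ∀ k : Finset (Fin 10), #k = 4 → ∃ a ∈ k, ∃ b ∈ k, a ≠ b ∧ ¬ graphR.Adj a b := by
    decide +kernel
  intro k hk
  obtain ⟨a, ha, b, hb, hab, hadj⟩ := hfour k hk.card_eq
  exact hadj (hk.isClique ha hb hab)

theorem isLeast_cliqueCoverWeights_graphR : IsLeast (cliqueCoverWeights graphR) (10 / 3) := by
  have hclique : ∀ k ∈ trianglesR, ∀ a ∈ k, ∀ b ∈ k, a ≠ b → graphR.Adj a b := by decide +kernel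
  simpa using isLeast_cliqueCoverWeights three_pos cliqueFree_four_graphR
    (fun k hk a ha b hb => hclique k hk a ha b hb) (by decide +kernel) (by decide +kernel)

theorem fractionalCliqueCoverNumber_graphR : fractionalCliqueCoverNumber graphR = 10 / 3 :=
  isLeast_cliqueCoverWeights_graphR.csInf_eq

theorem fractionalCliqueCoverBound_graphR : fractionalCliqueCoverBound graphR = 20 / 3 := by
  rw [fractionalCliqueCoverBound, fractionalCliqueCoverNumber_graphR, Fintype.card_fin]
  norm_num

end FractionalCliqueCover

/-! ### Linear strategies and clique decompositions -/

theorem ncard_preimage_div_card {A B : Type*} [AddGroup A] [Finite A] [AddGroup B] {f : A →+ B}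
    (hf : Function.Surjective f) (T : Set B) :
    ((f ⁻¹' T).ncard : ℝ) / Nat.card A = T.ncard / Nat.card B := by
  have : Finite B := Finite.of_surjective f hf
  let e := QuotientAddGroup.quotientKerEquivOfSurjective f hf
  have hcard : ∀ T : Set B, (f ⁻¹' T).ncard = T.ncard * Nat.card f.ker := fun T => by
    rw [← Set.ncard_preimage_of_injective_subset_range e.injective (s := T) (by simp), mul_comm,
      ← Nat.card_coe_set_eq, ← Nat.card_coe_set_eq, ← Nat.card_prod]
    exact Nat.card_congr (QuotientAddGroup.preimageMkEquivAddSubgroupProdSet f.ker (e ⁻¹' T))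
  have hA : Nat.card A = Nat.card B * Nat.card f.ker := by
    simpa only [Set.preimage_univ, Set.ncard_univ] using hcard Set.univ
  have hker : (Nat.card f.ker : ℝ) ≠ 0 := Nat.cast_ne_zero.2 Nat.card_pos.ne'
  rw [hcard, hA, Nat.cast_mul, Nat.cast_mul, mul_div_mul_right _ _ hker]

theorem winProb_eq_ncard_div_card {V : Type*} [Fintype V] {G : SimpleGraph V} {s : ℕ}
    (F : Strategy G s) : winProb G s F = (winSet G s F).ncard / Nat.card (V → Fin s) := by
  simp [winProb, Nat.card_fun]

section LinearStrategy

variable {V κ α : Type*} [Fintype V] [DecidableEq V]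

/-- Every vertex `v` guesses the value that makes `∑ w, M v w * a w` vanish, where `M v v` is taken
to be `1`. -/
def linearGuess [Ring α] (M : Matrix V V α) (a : V → α) (v : V) : α :=
  -∑ w with w ≠ v, M v w * a w

theorem linearGuess_eq_iff [Ring α] {M : Matrix V V α} {v : V} (hM : M v v = 1) (a : V → α) :
    linearGuess M a v = a v ↔ M.mulVec a v = 0 := by
  rw [Matrix.mulVec, dotProduct, ← Finset.add_sum_erase _ _ (Finset.mem_univ v), hM, one_mul,
    linearGuess, Finset.filter_ne', neg_eq_iff_add_eq_zero, add_comm]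

theorem forall_linearGuess_eq_iff [Ring α] [Fintype κ] [DecidableEq κ] {C : Matrix V κ α}
    {D P : Matrix κ V α} (hDC : D * C = 1) (hdiag : ∀ v, (C * P) v v = 1) (a : V → α) :
    (∀ v, linearGuess (C * P) a v = a v) ↔ P.mulVec a = 0 := by
  simp only [linearGuess_eq_iff (hdiag _), ← Matrix.mulVec_mulVec]
  refine ⟨fun h => ?_, fun h => by simp [h]⟩
  rw [← Matrix.one_mulVec (P.mulVec a), ← hDC, ← Matrix.mulVec_mulVec, funext h]
  exact Matrix.mulVec_zero D

variable {G : SimpleGraph V} {s : ℕ} [NeZero s]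

open scoped Fin.CommRing

theorem exists_strategy_guess_eq_linearGuess {M : Matrix V V (Fin s)}
    (hM : ∀ v w, w ≠ v → ¬ G.Adj v w → M v w = 0) :
    ∃ F : Strategy G s, ∀ a v, F.guess a v = linearGuess M a v := by
  have hlocal : ∀ a b : V → Fin s, ∀ v, (∀ u, G.Adj v u → a u = b u) →
      linearGuess M a v = linearGuess M b v := by
    refine fun a b v h => congrArg Neg.neg (Finset.sum_congr rfl fun w hw => ?_)
    by_cases hvw : G.Adj v w
    · rw [h w hvw]
    · rw [hM v w (Finset.mem_filter.1 hw).2 hvw, zero_mul, zero_mul]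
  simpa using exists_strategy_guess_eq (S := Set.univ) (linearGuess M) fun a _ b _ => hlocal a b

theorem winProb_eq_of_guess_eq_linearGuess [Fintype κ] [DecidableEq κ] {F : Strategy G s}
    {C Q : Matrix V κ (Fin s)} {D P : Matrix κ V (Fin s)}
    (hF : ∀ a v, F.guess a v = linearGuess (C * P) a v) (hDC : D * C = 1) (hPQ : P * Q = 1)
    (hdiag : ∀ v, (C * P) v v = 1) : winProb G s F = (1 / s) ^ Fintype.card κ := by
  have hwin : winSet G s F = P.mulVecLin.toAddMonoidHom ⁻¹' {0} := by
    ext a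
    simp [winSet, hF, forall_linearGuess_eq_iff hDC hdiag]
  have hsurj : Function.Surjective P.mulVecLin.toAddMonoidHom :=
    Matrix.mulVec_surjective_iff_exists_right_inverse.2 ⟨Q, hPQ⟩
  rw [winProb_eq_ncard_div_card, hwin, ncard_preimage_div_card hsurj]
  simp

end LinearStrategy

section CliqueDecomposition

variable {V W : Type*}

/-- A partition of the vertices of `G` into cliques indexed by `ι` and an induced copy of `H`;
`part x` is the index of the clique that contains `x`, or the vertex of `H` that `x` is a
copy of. -/
structure CliqueDecomposition (G : SimpleGraph V) (H : SimpleGraph W) (ι : Type*) where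
  part : V → ι ⊕ W
  copy : H ↪g G
  part_eq_inr_iff : ∀ x v, part x = .inr v ↔ copy v = x
  adj_of_part_eq_inl : ∀ i x y, part x = .inl i → part y = .inl i → x ≠ y → G.Adj x y
  exists_part_eq_inl : ∀ i, ∃ x, part x = .inl i

namespace CliqueDecomposition

variable {ι : Type*} {G : SimpleGraph V} {H : SimpleGraph W}

theorem part_copy (D : CliqueDecomposition G H ι) (v : W) : D.part (D.copy v) = .inr v :=
  (D.part_eq_inr_iff _ v).2 rfl

variable [Fintype V] [DecidableEq ι] [DecidableEq W]

/-- The clique with index `i` of a decomposition. -/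
def clique (D : CliqueDecomposition G H ι) (i : ι) : Finset V := {x | D.part x = .inl i}

variable (D : CliqueDecomposition G H ι)

theorem mem_clique {i : ι} {x : V} : x ∈ D.clique i ↔ D.part x = .inl i := by
  simp [clique]

theorem isClique_clique (i : ι) : G.IsClique (D.clique i : Set V) := fun x hx y hy =>
  D.adj_of_part_eq_inl i x y (D.mem_clique.1 hx) (D.mem_clique.1 hy)

theorem pairwise_disjoint_clique : Pairwise fun i j => Disjoint (D.clique i) (D.clique j) :=
  fun _ _ hij => Finset.disjoint_left.2 fun _ hi hj => hij <| Sum.inl_injective <|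
    (D.mem_clique.1 hi).symm.trans (D.mem_clique.1 hj)

theorem mem_range_copy_iff (x : V) : x ∈ Set.range D.copy ↔ ∀ i, x ∉ D.clique i := by
  simp only [Set.mem_range, ← D.part_eq_inr_iff, mem_clique]
  rcases D.part x with i | v <;> simp

variable {s : ℕ} [NeZero s]

/-- The sums of the values over the cliques, and the values on the copy of `H`. -/
def observe : (V → Fin s) →+ (ι → Fin s) × (W → Fin s) where
  toFun a := (fun i => ∑ x ∈ D.clique i, a x, a ∘ D.copy)
  map_zero' := Prod.ext (funext fun _ => Finset.sum_const_zero) rfl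
  map_add' _ _ := Prod.ext (funext fun _ => Finset.sum_add_distrib) rfl

theorem observe_surjective : Function.Surjective (D.observe (s := s)) := by
  classical
  choose rep hrep using D.exists_part_eq_inl
  rintro ⟨c, b⟩
  refine ⟨fun x => Sum.elim (fun i => if x = rep i then c i else 0) b (D.part x), ?_⟩
  refine Prod.ext (funext fun i => ?_) (funext fun v => by simp [observe, part_copy])
  calc ∑ x ∈ D.clique i, Sum.elim (fun i => if x = rep i then c i else 0) b (D.part x)
      = ∑ x ∈ D.clique i, if x = rep i then c i else 0 :=
        Finset.sum_congr rfl fun x hx => by rw [D.mem_clique.1 hx, Sum.elim_inl]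
    _ = c i := by rw [Finset.sum_ite_eq' _ (rep i), if_pos (D.mem_clique.2 (hrep i))]

variable [DecidableEq V]

theorem exists_strategy (F : Strategy H s) : ∃ F' : Strategy G s,
    (∀ i, ∀ x ∈ D.clique i, ∀ a, F'.guess a x = -∑ u ∈ (D.clique i).erase x, a u) ∧
      ∀ v a, F'.guess a (D.copy v) = F.guess (a ∘ D.copy) v := by
  let g (a : V → Fin s) (x : V) : Fin s :=
    Sum.elim (fun i => -∑ u ∈ (D.clique i).erase x, a u) (F.guess (a ∘ D.copy)) (D.part x)
  have hlocal : ∀ a b : V → Fin s, ∀ x, (∀ u, G.Adj x u → a u = b u) → g a x = g b x := by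
    intro a b x h
    rcases hx : D.part x with i | v
    · simp only [g, hx, Sum.elim_inl]
      refine congrArg Neg.neg <| Finset.sum_congr rfl fun u hu => h u ?_
      rw [Finset.mem_erase, mem_clique] at hu
      exact D.adj_of_part_eq_inl i x u hx hu.2 hu.1.symm
    · obtain rfl := (D.part_eq_inr_iff x v).1 hx
      simp only [g, hx, Sum.elim_inr]
      exact congrArg (F v) (funext fun u => h _ (D.copy.map_rel_iff.2 u.2))
  obtain ⟨F', hF'⟩ := exists_strategy_guess_eq (S := Set.univ) g fun a _ b _ => hlocal a b
  exact ⟨F', fun i x hx a => by simp [hF', g, D.mem_clique.1 hx],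
    fun v a => by simp [hF', g, part_copy]⟩

theorem winSet_eq_preimage_observe {F : Strategy H s} {F' : Strategy G s}
    (hclique : ∀ i, ∀ x ∈ D.clique i, ∀ a, F'.guess a x = -∑ u ∈ (D.clique i).erase x, a u)
    (hcopy : ∀ v a, F'.guess a (D.copy v) = F.guess (a ∘ D.copy) v) :
    winSet G s F' = D.observe ⁻¹' ({0} ×ˢ winSet H s F) := by
  ext a
  have hsum : ∀ i, ∀ x ∈ D.clique i, F'.guess a x = a x ↔ ∑ u ∈ D.clique i, a u = 0 :=
    fun i x hx => by
      rw [hclique i x hx, ← Finset.add_sum_erase _ _ hx, neg_eq_iff_add_eq_zero, add_comm]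
  change (∀ x, F'.guess a x = a x) ↔
    (fun i => ∑ x ∈ D.clique i, a x) = 0 ∧ ∀ v, F.guess (a ∘ D.copy) v = a (D.copy v)
  simp only [funext_iff, Pi.zero_apply, ← hcopy]
  refine ⟨fun h => ⟨fun i => ?_, fun v => h _⟩, fun h x => ?_⟩
  · obtain ⟨x, hx⟩ := D.exists_part_eq_inl i
    exact (hsum i x (D.mem_clique.2 hx)).1 (h x)
  · rcases hx : D.part x with i | v
    · exact (hsum i x (D.mem_clique.2 hx)).2 (h.1 i)
    · obtain rfl := (D.part_eq_inr_iff x v).1 hx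
      exact h.2 v

theorem winProb_eq [Fintype ι] [Fintype W] {F : Strategy H s} {F' : Strategy G s}
    (hclique : ∀ i, ∀ x ∈ D.clique i, ∀ a, F'.guess a x = -∑ u ∈ (D.clique i).erase x, a u)
    (hcopy : ∀ v a, F'.guess a (D.copy v) = F.guess (a ∘ D.copy) v) :
    winProb G s F' = (1 / s) ^ Fintype.card ι * winProb H s F := by
  rw [winProb_eq_ncard_div_card, D.winSet_eq_preimage_observe hclique hcopy,
    ncard_preimage_div_card D.observe_surjective, Set.ncard_prod, winProb]
  simp [field]

end CliqueDecomposition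

end CliqueDecomposition

section StrategyR

instance : DecidableRel (blowup graphR 4).Adj := fun x y =>
  inferInstanceAs (Decidable (graphR.Adj x.1 y.1))

/-- The partition of `R(4)` into nine triangles and a copy of `R_c`; row `v`, column `i` of the
table is the part of the vertex `(v, i)`. -/
def decompositionR : CliqueDecomposition (blowup graphR 4) graphRc (Fin 9) where
  part x := (![
    ![.inr 0, .inl 0, .inl 1, .inl 2],
    ![.inr 1, .inl 0, .inl 5, .inl 8],
    ![.inr 2, .inl 0, .inl 3, .inl 5],
    ![.inr 3, .inl 1, .inl 3, .inl 7],
    ![.inr 4, .inl 1, .inl 6, .inl 7],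
    ![.inr 5, .inl 2, .inl 4, .inl 6],
    ![.inr 6, .inl 2, .inl 4, .inl 8],
    ![.inr 7, .inr 10, .inl 3, .inl 4],
    ![.inr 8, .inr 11, .inl 5, .inl 6],
    ![.inr 9, .inr 12, .inl 7, .inl 8]] : Fin 10 → Fin 4 → Fin 9 ⊕ Fin 13) x.1 x.2
  copy :=
    { toFun := fun v => (cloneOf v, if v < 10 then 0 else 1)
      inj' := by decide
      map_rel_iff' := Iff.rfl }
  part_eq_inr_iff := by decide +kernel
  adj_of_part_eq_inl := by decide +kernel
  exists_part_eq_inl := by decide +kernel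

theorem isNClique_clique_decompositionR (i : Fin 9) :
    (blowup graphR 4).IsNClique 3 (decompositionR.clique i) := by
  refine ⟨decompositionR.isClique_clique i, ?_⟩
  revert i
  decide +kernel

/-- A right inverse of `rcCheck`. -/
def rcCheckInv : Matrix (Fin 13) (Fin 4) (Fin 3) :=
  !![1, 0, 0, 0; 0, 0, 0, 0; 0, 0, 0, 0; 0, 0, 0, 0; 0, 0, 0, 0; 0, 0, 0, 0; 0, 0, 0, 0;
     0, 2, 2, 1; 0, 2, 1, 2; 0, 1, 2, 2; 0, 0, 0, 0; 0, 0, 0, 0; 0, 0, 0, 0]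

/-- A left inverse of `rcComb`: the players `1`, `9`, `8`, `10` each use a single condition. -/
def rcCombInv : Matrix (Fin 4) (Fin 13) (Fin 3) :=
  (1 : Matrix (Fin 13) (Fin 13) (Fin 3)).submatrix ![0, 8, 7, 9] id

open scoped Fin.CommRing

theorem exists_strategy_graphRc : ∃ F : Strategy graphRc 3,
    (∀ a v, F.guess a v = rcGuess a v) ∧ winProb graphRc 3 F = (1 / 3) ^ 4 := by
  have hlocal : ∀ v w, w ≠ v → ¬ graphR.Adj (cloneOf v) (cloneOf w) →
      (rcComb * rcCheck) v w = 0 := by decide +kernel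
  have hdiag : ∀ v, (rcComb * rcCheck) v v = 1 := by decide +kernel
  have hcomb : rcCombInv * rcComb = 1 := by decide +kernel
  have hcheck : rcCheck * rcCheckInv = 1 := by decide +kernel
  obtain ⟨F, hF⟩ := exists_strategy_guess_eq_linearGuess (G := graphRc) hlocal
  exact ⟨F, hF, by simpa using winProb_eq_of_guess_eq_linearGuess hF hcomb hcheck hdiag⟩

theorem exists_strategy_blowup_graphR : ∃ F : Strategy (blowup graphR 4) 3,
    (∀ i, ∀ x ∈ decompositionR.clique i, ∀ a,
      F.guess a x = -∑ u ∈ (decompositionR.clique i).erase x, a u) ∧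
    (∀ v a, F.guess a (decompositionR.copy v) = rcGuess (a ∘ decompositionR.copy) v) ∧
    winProb (blowup graphR 4) 3 F = (1 / 3) ^ 13 := by
  obtain ⟨F, hF, hprob⟩ := exists_strategy_graphRc
  obtain ⟨F', hclique, hcopy⟩ := decompositionR.exists_strategy F
  refine ⟨F', hclique, fun v a => (hcopy v a).trans (hF _ v), ?_⟩
  rw [decompositionR.winProb_eq hclique hcopy, hprob, Fintype.card_fin]
  norm_num

theorem exists_isCode_graphR : ∃ S : Set (Fin 10 → Fin 4 → Fin 3),
    IsCode graphR S ∧ S.Nonempty ∧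
      Real.logb (Fintype.card (Fin 4 → Fin 3)) S.ncard = 27 / 4 := by
  obtain ⟨F, -, -, hprob⟩ := exists_strategy_blowup_graphR
  have hne : (winSet (blowup graphR 4) 3 F).Nonempty := Set.nonempty_iff_ne_empty.2 fun h => by
    norm_num [winProb, h] at hprob
  refine ⟨_, (isCode_winSet F).image_curry, hne.image _, ?_⟩
  have hlog : Real.logb (3 : ℕ) 3 = 1 := Real.logb_self_eq_one (by norm_num)
  rw [logb_ncard_image_curry_winSet (by simp) hne, hprob, one_div, Real.logb_pow, Real.logb_inv,
    hlog]
  norm_num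

end StrategyR

end GuessingGame

theorem mainTheorem4 :
    -- the asymptotic guessing number of `R` is `27/4`
    HasAsymptoticGuessingNumber graphR (27 / 4) ∧
    -- the fractional clique cover number of `R` is attained, and the bound it gives is `20/3`
    IsLeast (cliqueCoverWeights graphR) (fractionalCliqueCoverNumber graphR) ∧
    fractionalCliqueCoverBound graphR = 20 / 3 ∧
    fractionalCliqueCoverBound graphR ≠ 27 / 4 ∧
    -- the Shannon bound of `R` is `27/4`
    IsShannonBound graphR (27 / 4) ∧
    -- the strategy on `R(4)` over an alphabet of size `3`
    (∃ (T : Fin 9 → Finset (Fin 10 × Fin 4)) (φ : graphRc ↪g blowup graphR 4)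
        (F : Strategy (blowup graphR 4) 3),
      (∀ i, (blowup graphR 4).IsNClique 3 (T i)) ∧
      Pairwise (fun i j => Disjoint (T i) (T j)) ∧
      (∀ x, x ∈ Set.range φ ↔ ∀ i, x ∉ T i) ∧
      (∀ i, ∀ v ∈ T i, ∀ a, F.guess a v = -∑ u ∈ (T i).erase v, a u) ∧
      (∀ v a, F.guess a (φ v) = rcGuess (a ∘ φ) v) ∧
      winProb (blowup graphR 4) 3 F = (1 / 3) ^ 13) := by
  obtain ⟨S, hS, hne, hlog⟩ := exists_isCode_graphR
  have hα : 1 < Fintype.card (Fin 4 → Fin 3) := by simp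
  have hupper := mem_upperBounds_shannonValues_graphR
  rw [← hlog] at hupper
  obtain ⟨F, hclique, hcopy, hprob⟩ := exists_strategy_blowup_graphR
  refine ⟨?_, ?_, fractionalCliqueCoverBound_graphR, ?_, ?_, decompositionR.clique,
    decompositionR.copy, F, isNClique_clique_decompositionR,
    decompositionR.pairwise_disjoint_clique, decompositionR.mem_range_copy_iff, hclique, hcopy,
    hprob⟩
  · exact hlog ▸ hS.hasAsymptoticGuessingNumber hne hα hupper
  · exact fractionalCliqueCoverNumber_graphR ▸ isLeast_cliqueCoverWeights_graphR
  · rw [fractionalCliqueCoverBound_graphR]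
    norm_num
  · exact hlog ▸ ⟨hS.logb_ncard_mem_shannonValues, hupper⟩
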